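/- A contextuality scenario $H$ consists of a finite set $V(H)$ of vertices and a set $E(H)\subseteq 2^{V(H)}$ of edges with $\bigcup_{e\in E(H)}e=V(H)$. Its non-orthogonality graph $\mathrm{NO}(H)$ is the graph on $V(H)$ in which $u\sim v$ if and only if no edge $e\in E(H)$ contains both $u$ and $v$. A probabilistic model on $H$ is a map $p:V(H)\to[0,1]$ with $\sum_{v\in e}p(v)=1$ for every $e\in E(H)$. It is quantum if there are a complex Hilbert space $\mathcal H$ (of arbitrary dimension), a positive trace-class operator $\rho$ on $\mathcal H$ with $\mathrm{tr}\,\rho=1$, and orthogonal projections $P_v$ on $\mathcal H$ for $v\in V(H)$ such that $\sum_{v\in e}P_v=\mathbb 1_{\mathcal H}$ for every $e\in E(H)$ and $p(v)=\mathrm{tr}(\rho P_v)$ for every $v\in V(H)$. **Theorem.** There exist two contextuality scenarios $H$ and $H'$ with $V(H)=V(H')$ and $\mathrm{NO}(H)=\mathrm{NO}(H')$, together with vertex weights $v\mapsto p(v)$ which define a probabilistic model both on $H$ and on $H'$, such that $p$ is quantum on $H$ but not on $H'$. Consequently, quantumness of probabilistic models is not determined by any graph invariant of the weighted non-orthogonality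 graph: if $X$ is a function (with values in an arbitrary set $A$) of finite graphs with real vertex weights that takes equal values on isomorphic weighted graphs, and $S\subseteq A$ is any subset, then it is not the case that for all contextuality scenarios $H$ and all probabilistic models $p$ on $H$ one has: $p$ is quantum on $H$ if and only if $X(\mathrm{NO}(H),p)\in S$. -/

import Mathlib

open scoped InnerProductSpace

universe u v w

/-- A contextuality scenario on a (finite) vertex set `V`: a family of subsets of `V`, the edges,
which together cover `V`. -/
structure ContextualityScenario (V : Type*) where
  /-- The set of edges (measurements). -/
  edges : Set (Finset V)
  /-- Every vertex (outcome) belongs to at least one edge. -/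
  cover : ∀ v : V, ∃ e ∈ edges, v ∈ e

namespace ContextualityScenario

/-- The non-orthogonality graph: two vertices are adjacent iff no edge contains both of them.
(A vertex is never adjacent to itself, since the edges cover `V`.) -/
def nonOrthogonalityGraph {V : Type*} (H : ContextualityScenario V) : SimpleGraph V where
  Adj u v := ¬ ∃ e ∈ H.edges, u ∈ e ∧ v ∈ e
  symm := ⟨fun _ _ h ⟨e, he, hv, hu⟩ => h ⟨e, he, hu, hv⟩⟩
  loopless := ⟨fun v h => by
    obtain ⟨e, he, hv⟩ := H.cover v
    exact h ⟨e, he, hv, hv⟩⟩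

/-- A probabilistic model: an assignment of probabilities to the vertices that is normalized on
every edge. -/
def IsProbabilisticModel {V : Type*} (H : ContextualityScenario V) (p : V → ℝ) : Prop :=
  (∀ v, p v ∈ Set.Icc (0 : ℝ) 1) ∧ ∀ e ∈ H.edges, ∑ v ∈ e, p v = 1

end ContextualityScenario

/-- `HasTrace A t`: the bounded operator `A` on a complex Hilbert space is of trace class with
trace `t`, i.e. for every Hilbert basis `b` the series `∑ᵢ ⟪bᵢ, A bᵢ⟫` converges unconditionally
to `t`. -/
def HasTrace {𝓗 : Type*} [NormedAddCommGroup 𝓗] [InnerProductSpace ℂ 𝓗] [CompleteSpace 𝓗]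
    (A : 𝓗 →L[ℂ] 𝓗) (t : ℂ) : Prop :=
  ∀ (s : Set 𝓗) (b : HilbertBasis s ℂ 𝓗), HasSum (fun i => ⟪b i, A (b i)⟫_ℂ) t

/-- A quantum state: a positive operator of trace one. -/
def IsQuantumState {𝓗 : Type*} [NormedAddCommGroup 𝓗] [InnerProductSpace ℂ 𝓗] [CompleteSpace 𝓗]
    (ρ : 𝓗 →L[ℂ] 𝓗) : Prop :=
  ρ.IsPositive ∧ HasTrace ρ 1

namespace ContextualityScenario

/-- An assignment of probabilities `p` is a quantum model on `H` if there are a complex Hilbert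
space (of any dimension), a quantum state `ρ` and orthogonal projections `P v` that sum to the
identity over each edge of `H`, such that `p v = tr (ρ P_v)` for all `v`. -/
def IsQuantumModel {V : Type v} (H : ContextualityScenario V) (p : V → ℝ) : Prop :=
  (∀ v, p v ∈ Set.Icc (0 : ℝ) 1) ∧
  ∃ (𝓗 : Type u) (_ : NormedAddCommGroup 𝓗) (_ : InnerProductSpace ℂ 𝓗) (_ : CompleteSpace 𝓗)
    (ρ : 𝓗 →L[ℂ] 𝓗) (P : V → 𝓗 →L[ℂ] 𝓗),
    IsQuantumState ρ ∧
    (∀ v, IsStarProjection (P v)) ∧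
    (∀ e ∈ H.edges, ∑ v ∈ e, P v = 1) ∧
    ∀ v, HasTrace (ρ * P v) (p v : ℂ)

end ContextualityScenario

/-- A graph invariant of finite vertex-weighted graphs, with values in `α`: a function of weighted
graphs that agrees on any two weighted graphs related by a weight-preserving graph isomorphism. -/
structure WeightedGraphInvariant (α : Type*) where
  /-- The value of the invariant at a finite graph with vertex weights. -/
  val : ∀ {V : Type} [Finite V], SimpleGraph V → (V → ℝ) → α
  /-- Isomorphic weighted graphs have the same value. -/
  iso_invariant : ∀ {V W : Type} [Finite V] [Finite W] (G : SimpleGraph V) (G' : SimpleGraph W)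
    (φ : G ≃g G') (p : V → ℝ) (q : W → ℝ), (∀ v, q (φ v) = p v) → val G p = val G' q

/-! ### Traces and positivity. -/

section Trace

variable {𝓗 : Type*} [NormedAddCommGroup 𝓗] [InnerProductSpace ℂ 𝓗] [CompleteSpace 𝓗]

/-! `NO(H)` records which vertices are orthogonal, but not which orthogonal sets are complete.
Complete every orthogonal set of at most two vertices of a scenario by its own new vertex: this
keeps all orthogonality relations and drops the normalizations (`pairScenario`). Putting the old
edges back (`fullScenario`) does not change the graph, but forces the old projections to sum to the
identity.

The base scenario is Specker's triangle with pairwise correlations -1/2. With normalization, the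
three measurements are commuting projections. Two of three bits always coincide, so the coincidence
probabilities sum to at least 1, whereas here they sum to 3/4 (`not_isQuantumModel_speckerModel`).
Without normalization, orthogonal rank-one projections suffice, and explicit vectors give the
required probabilities (`speckerModel_isQuantumModel_pairScenario`). -/

theorem HasTrace.add {A B : 𝓗 →L[ℂ] 𝓗} {a b : ℂ} (hA : HasTrace A a) (hB : HasTrace B b) :
    HasTrace (A + B) (a + b) := fun s e => by
  simpa [inner_add_right] using (hA s e).add (hB s e)

theorem HasTrace.sub {A B : 𝓗 →L[ℂ] 𝓗} {a b : ℂ} (hA : HasTrace A a) (hB : HasTrace B b) :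
    HasTrace (A - B) (a - b) := fun s e => by
  simpa [inner_sub_right] using (hA s e).sub (hB s e)

theorem HasTrace.smul {A : 𝓗 →L[ℂ] 𝓗} {a : ℂ} (c : ℂ) (hA : HasTrace A a) :
    HasTrace (c • A) (c * a) := fun s e => by
  simpa [inner_smul_right] using (hA s e).mul_left c

theorem HasTrace.sum {ι : Type*} {A : ι → 𝓗 →L[ℂ] 𝓗} {a : ι → ℂ} (t : Finset ι)
    (hA : ∀ i ∈ t, HasTrace (A i) (a i)) : HasTrace (∑ i ∈ t, A i) (∑ i ∈ t, a i) := fun s e => by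
  simpa [inner_sum, sum_apply] using
    hasSum_sum fun i hi => hA i hi s e

/-- A star projection is diagonal, with eigenvalues `0` and `1`, in some Hilbert basis. -/
theorem IsStarProjection.exists_hilbertBasis {G : 𝓗 →L[ℂ] 𝓗} (hG : IsStarProjection G) :
    ∃ (s : Set 𝓗) (b : HilbertBasis s ℂ 𝓗), ∀ i, G (b i) = b i ∨ G (b i) = 0 := by
  have hsymm : ∀ x y, ⟪G x, y⟫_ℂ = ⟪x, G y⟫_ℂ := hG.isSelfAdjoint.isSymmetric
  have hidem : ∀ x, G (G x) = G x := fun x => congr($(hG.isIdempotentElem.eq) x)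
  let K : Submodule ℂ 𝓗 := LinearMap.ker (1 - G : 𝓗 →L[ℂ] 𝓗).toLinearMap
  have hK : ∀ x, x ∈ K ↔ G x = x := fun x => by
    simp [K, sub_eq_zero, eq_comm (a := x)]
  have : CompleteSpace K := (1 - G : 𝓗 →L[ℂ] 𝓗).isClosed_ker.completeSpace_coe
  obtain ⟨w, c, hc⟩ := _root_.exists_hilbertBasis ℂ K
  have hortho : Orthonormal ℂ ((↑) : ((↑) '' w : Set 𝓗) → 𝓗) := by
    have h1 : Orthonormal ℂ fun i : w => ((i : K) : 𝓗) := by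
      have := c.orthonormal.comp_linearIsometry K.subtypeₗᵢ
      rw [hc] at this
      exact this
    have := h1.toSubtypeRange
    convert this using 2 <;> simp [Set.image_eq_range]
  -- The vectors added to the basis of `K` are orthogonal to `K`. Their images under `G` lie in `K`
  -- and have zero coordinates there.
  obtain ⟨s, b, hsub, hb⟩ := hortho.exists_hilbertBasis_extension
  refine ⟨s, b, fun i => ?_⟩
  by_cases hi : (i : 𝓗) ∈ ((↑) '' w : Set 𝓗)
  · left
    obtain ⟨x, -, hx⟩ := hi
    rw [hb, ← hx]
    exact (hK x).1 x.2
  · right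
    have hmem : G (b i) ∈ K := (hK _).2 (hidem _)
    have hz : c.repr ⟨G (b i), hmem⟩ = 0 := by
      ext j
      rw [c.repr_apply_apply, Submodule.coe_inner, ← hsymm, (hK _).1 (c j).2]
      have hj : ((c j : K) : 𝓗) ∈ ((↑) '' w : Set 𝓗) := ⟨c j, by rw [hc]; exact j.2, rfl⟩
      have hne : (⟨_, hsub hj⟩ : s) ≠ i := fun h => hi (h ▸ hj)
      have := b.orthonormal.2 hne
      rw [hb] at this
      rw [hb]
      exact this
    have := c.repr.map_eq_zero_iff.1 hz
    exact congrArg Subtype.val this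

/-- The trace of the product of a positive operator and a projection is nonnegative. -/
theorem HasTrace.re_nonneg_of_isPositive_mul_isStarProjection {ρ G : 𝓗 →L[ℂ] 𝓗} {t : ℂ}
    (hρ : ρ.IsPositive) (hG : IsStarProjection G) (h : HasTrace (ρ * G) t) : 0 ≤ t.re := by
  -- In a basis that diagonalizes `G`, each diagonal term of `ρ * G` is either that of `ρ` or zero.
  obtain ⟨s, b, hb⟩ := hG.exists_hilbertBasis
  refine (Complex.hasSum_re (h s b)).nonneg fun i => ?_
  rcases hb i with hi | hi
  · simpa [hi] using hρ.re_inner_nonneg_right (b i)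
  · simp [hi]

/-- Up to the factor `1 / ‖ψ‖ ^ 2`, this is Parseval's identity for `P ψ` and `ψ`. -/
theorem hasTrace_starProjection_singleton_mul (ψ : 𝓗) {P : 𝓗 →L[ℂ] 𝓗}
    (hP : IsSelfAdjoint P) :
    HasTrace ((ℂ ∙ ψ).starProjection * P) (⟪ψ, P ψ⟫_ℂ / ((‖ψ‖ ^ 2 : ℝ) : ℂ)) := fun s b => by
  have h := (b.hasSum_inner_mul_inner (P ψ) ψ).div_const ((‖ψ‖ ^ 2 : ℝ) : ℂ)
  have hsymm : ∀ x y, ⟪P x, y⟫_ℂ = ⟪x, P y⟫_ℂ := hP.isSymmetric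
  rw [hsymm] at h
  refine h.congr_fun fun i => ?_
  rw [mul_apply_eq_comp, Submodule.starProjection_singleton, inner_smul_right, hsymm]
  exact div_mul_eq_mul_div _ _ _

theorem isQuantumState_starProjection_singleton {ψ : 𝓗} (hψ : ψ ≠ 0) :
    IsQuantumState (ℂ ∙ ψ).starProjection := by
  refine ⟨?_, ?_⟩
  · exact (ContinuousLinearMap.nonneg_iff_isPositive _).1 isStarProjection_starProjection.nonneg
  · have h := hasTrace_starProjection_singleton_mul ψ (P := 1) (.one _)
    have h2 : ((‖ψ‖ ^ 2 : ℝ) : ℂ) ≠ 0 := by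
      simpa using hψ
    rw [mul_one, one_apply_eq_self, inner_self_eq_norm_sq_to_K] at h
    push_cast at h h2
    convert h using 1
    exact (div_self h2).symm

end Trace

/-! ### Orthogonality of projections. -/

section Projections

theorem IsStarProjection.sum {R ι : Type*} [NonUnitalRing R] [StarRing R] {P : ι → R}
    (t : Finset ι) (hP : ∀ i ∈ t, IsStarProjection (P i))
    (hort : ∀ i ∈ t, ∀ j ∈ t, i ≠ j → P i * P j = 0) : IsStarProjection (∑ i ∈ t, P i) := by
  classical
  induction t using Finset.induction_on with
  | empty => simp
  | insert a t ha ih =>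
    rw [Finset.sum_insert ha]
    refine (hP a (by simp)).add (ih (fun i hi => hP i (by simp [hi])) fun i hi j hj =>
      hort i (by simp [hi]) j (by simp [hj])) ?_
    rw [Finset.mul_sum]
    exact Finset.sum_eq_zero fun j hj => hort a (by simp) j (by simp [hj])
      fun h => ha (h ▸ hj)

/-- Projections that sum to the identity are pairwise orthogonal. -/
theorem IsStarProjection.mul_eq_zero_of_sum_eq_one {𝓗 : Type*} [NormedAddCommGroup 𝓗]
    [InnerProductSpace ℂ 𝓗] [CompleteSpace 𝓗] {ι : Type*} {P : ι → 𝓗 →L[ℂ] 𝓗} {t : Finset ι}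
    (hP : ∀ i ∈ t, IsStarProjection (P i)) (hsum : ∑ i ∈ t, P i = 1)
    {i j : ι} (hi : i ∈ t) (hj : j ∈ t) (hij : i ≠ j) : P i * P j = 0 := by
  classical
  have key : ∀ k ∈ t, ∀ x, RCLike.re ⟪P k x, x⟫_ℂ = ‖P k x‖ ^ 2 := fun k hk x => by
    have h1 : P k (P k x) = P k x := congr($((hP k hk).isIdempotentElem.eq) x)
    have h2 : ⟪P k (P k x), x⟫_ℂ = ⟪P k x, P k x⟫_ℂ := (hP k hk).isSelfAdjoint.isSymmetric _ _
    rw [← inner_self_eq_norm_sq (𝕜 := ℂ), ← h2, h1]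
  ext x
  have h1 : P j (P j x) = P j x := congr($((hP j hj).isIdempotentElem.eq) x)
  -- On `P j x` the quadratic forms `‖P k (P j x)‖ ^ 2` sum to `‖P j x‖ ^ 2`. The term `k = j`
  -- already accounts for all of it, so the others vanish.
  have h := congrArg (fun A : 𝓗 →L[ℂ] 𝓗 => RCLike.re ⟪A (P j x), P j x⟫_ℂ) hsum
  simp only [sum_apply, sum_inner, map_sum, one_apply_eq_self] at h
  rw [inner_self_eq_norm_sq, Finset.sum_congr rfl fun k hk => key k hk _,
    ← Finset.add_sum_erase _ _ hj, h1, add_eq_left,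
    Finset.sum_eq_zero_iff_of_nonneg fun _ _ => by positivity] at h
  simpa using h i (by simp [hi, hij])

end Projections

/-! ### Two scenarios with the same orthogonality relations. -/

namespace ContextualityScenario

variable {B : Type*}

/-- The sets of at most two vertices that are contained in an edge. -/
abbrev OrthoPair (H : ContextualityScenario B) : Type _ :=
  {S : Finset B // S.card ≤ 2 ∧ ∃ e ∈ H.edges, S ⊆ e}

/-- An edge that completes a set of at most two orthogonal vertices by one new vertex. -/
def pairEdge [DecidableEq B] (H : ContextualityScenario B) (S : H.OrthoPair) :
    Finset (B ⊕ H.OrthoPair) :=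
  insert (Sum.inr S) (S.1.map Function.Embedding.inl)

theorem exists_inl_mem_pairEdge [DecidableEq B] (H : ContextualityScenario B) (b : B) :
    ∃ S, (Sum.inl b : B ⊕ H.OrthoPair) ∈ H.pairEdge S := by
  obtain ⟨e, he, hb⟩ := H.cover b
  exact ⟨⟨{b}, by simp, e, he, by simpa using hb⟩, by simp [pairEdge]⟩

/-- The scenario that keeps the orthogonality relations of `H`, but not its normalizations. -/
def pairScenario [DecidableEq B] (H : ContextualityScenario B) :
    ContextualityScenario (B ⊕ H.OrthoPair) where
  edges := Set.range H.pairEdge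
  cover v := by
    rcases v with b | S
    · obtain ⟨S, hS⟩ := H.exists_inl_mem_pairEdge b
      exact ⟨_, ⟨S, rfl⟩, hS⟩
    · exact ⟨_, ⟨S, rfl⟩, by simp [pairEdge]⟩

/-- The scenario `H.pairScenario` together with the normalizations of `H`. -/
def fullScenario [DecidableEq B] (H : ContextualityScenario B) :
    ContextualityScenario (B ⊕ H.OrthoPair) where
  edges := H.pairScenario.edges ∪ (fun e => e.map Function.Embedding.inl) '' H.edges
  cover v := by
    obtain ⟨e, he, hv⟩ := H.pairScenario.cover v
    exact ⟨e, Or.inl he, hv⟩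

/-- Extension of a family indexed by the vertices of `H` to the vertices of `H.pairScenario`. -/
def pairExtend {R : Type*} [Ring R] (H : ContextualityScenario B) (f : B → R) :
    B ⊕ H.OrthoPair → R :=
  Sum.elim f fun S => 1 - ∑ b ∈ S.1, f b

variable [DecidableEq B] (H : ContextualityScenario B)

theorem sum_pairEdge_pairExtend {R : Type*} [Ring R] (f : B → R) (S : H.OrthoPair) :
    ∑ v ∈ H.pairEdge S, H.pairExtend f v = 1 := by
  rw [pairEdge, Finset.sum_insert (by simp)]
  simp [pairExtend]

theorem nonOrthogonalityGraph_pairScenario :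
    H.pairScenario.nonOrthogonalityGraph = H.fullScenario.nonOrthogonalityGraph := by
  ext x y
  refine not_congr ⟨fun ⟨e, he, h⟩ => ⟨e, Or.inl he, h⟩, ?_⟩
  rintro ⟨e, he | ⟨f, hf, rfl⟩, hx, hy⟩
  · exact ⟨e, he, hx, hy⟩
  · obtain ⟨a, ha, rfl⟩ := Finset.mem_map.1 hx
    obtain ⟨b, hb, rfl⟩ := Finset.mem_map.1 hy
    -- The bound on the cardinality also admits `a = b`, where the pair is a singleton.
    refine ⟨_, ⟨⟨{a, b}, Finset.card_le_two, f, hf, ?_⟩, rfl⟩, ?_, ?_⟩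
    · simp [Finset.insert_subset_iff, ha, hb]
    · simp [pairEdge]
    · simp [pairEdge]

variable {H} {p : B → ℝ}

theorem IsProbabilisticModel.fullScenario (hp : H.IsProbabilisticModel p) :
    H.fullScenario.IsProbabilisticModel (H.pairExtend p) := by
  refine ⟨?_, ?_⟩
  · rintro (b | ⟨S, -, e, he, hS⟩)
    · exact hp.1 b
    · have h1 : ∑ b ∈ S, p b ≤ ∑ b ∈ e, p b :=
        Finset.sum_le_sum_of_subset_of_nonneg hS fun b _ _ => (hp.1 b).1
      have h2 : 0 ≤ ∑ b ∈ S, p b := Finset.sum_nonneg fun b _ => (hp.1 b).1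
      rw [hp.2 e he] at h1
      simp only [pairExtend, Sum.elim_inr, Set.mem_Icc]
      constructor <;> linarith
  · rintro e (⟨S, rfl⟩ | ⟨e, he, rfl⟩)
    · exact H.sum_pairEdge_pairExtend p S
    · simpa [pairExtend] using hp.2 e he

theorem IsProbabilisticModel.pairScenario (hp : H.IsProbabilisticModel p) :
    H.pairScenario.IsProbabilisticModel (H.pairExtend p) :=
  ⟨hp.fullScenario.1, fun e he => hp.fullScenario.2 e (Or.inl he)⟩

theorem IsQuantumModel.of_fullScenario
    (h : IsQuantumModel.{u} H.fullScenario (H.pairExtend p)) : IsQuantumModel.{u} H p := by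
  obtain ⟨hp, 𝓗, i1, i2, i3, ρ, P, hρ, hP, hsum, htr⟩ := h
  refine ⟨fun b => hp (.inl b), 𝓗, i1, i2, i3, ρ, fun b => P (.inl b), hρ, fun b => hP _,
    fun e he => ?_, fun b => htr (.inl b)⟩
  simpa using hsum _ (Or.inr ⟨e, he, rfl⟩)

/-- For `H.pairScenario`, orthogonality of the projections along the edges of `H` suffices. -/
theorem IsProbabilisticModel.isQuantumModel_pairScenario (hp : H.IsProbabilisticModel p)
    {𝓗 : Type u} [NormedAddCommGroup 𝓗] [InnerProductSpace ℂ 𝓗] [CompleteSpace 𝓗]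
    {ρ : 𝓗 →L[ℂ] 𝓗} {P : B → 𝓗 →L[ℂ] 𝓗} (hρ : IsQuantumState ρ)
    (hP : ∀ b, IsStarProjection (P b))
    (hort : ∀ e ∈ H.edges, ∀ a ∈ e, ∀ b ∈ e, a ≠ b → P a * P b = 0)
    (htr : ∀ b, HasTrace (ρ * P b) (p b : ℂ)) :
    IsQuantumModel.{u} H.pairScenario (H.pairExtend p) := by
  refine ⟨hp.pairScenario.1, 𝓗, _, _, ‹_›, ρ, H.pairExtend P, hρ, ?_, ?_, ?_⟩
  · rintro (b | ⟨S, -, e, he, hS⟩)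
    · exact hP b
    · exact (IsStarProjection.sum S (fun b _ => hP b)
        fun a ha b hb => hort e he a (hS ha) b (hS hb)).one_sub
  · rintro _ ⟨S, rfl⟩
    exact H.sum_pairEdge_pairExtend P S
  · rintro (b | S)
    · exact htr b
    · simp only [pairExtend, Sum.elim_inr, mul_sub, mul_one, Finset.mul_sum]
      push_cast
      exact hρ.2.sub (HasTrace.sum _ fun b _ => htr b)

end ContextualityScenario

/-! ### Rank-one projections from integer vectors. -/

section RankOne

/-- A vector with integer coordinates, as an element of a complex Euclidean space. -/
def intVector {n : ℕ} (a : Fin n → ℤ) : EuclideanSpace ℂ (ULift.{u} (Fin n)) :=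
  WithLp.toLp 2 fun i => (a i.down : ℂ)

theorem inner_intVector {n : ℕ} (a b : Fin n → ℤ) :
    ⟪intVector.{u} a, intVector b⟫_ℂ = ((a ⬝ᵥ b : ℤ) : ℂ) := by
  simp only [intVector, PiLp.inner_apply, dotProduct]
  push_cast
  refine Fintype.sum_equiv Equiv.ulift _ _ fun i => ?_
  simp [mul_comm]

theorem norm_sq_intVector {n : ℕ} (a : Fin n → ℤ) :
    ‖intVector.{u} a‖ ^ 2 = ((a ⬝ᵥ a : ℤ) : ℝ) := by
  rw [← inner_self_eq_norm_sq (𝕜 := ℂ), inner_intVector]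
  simp

theorem starProjection_singleton_mul_eq_zero {𝓗 : Type*} [NormedAddCommGroup 𝓗]
    [InnerProductSpace ℂ 𝓗] {x y : 𝓗} (h : ⟪x, y⟫_ℂ = 0) :
    (ℂ ∙ x).starProjection * (ℂ ∙ y).starProjection = 0 := by
  ext z
  simp [Submodule.starProjection_singleton, h]

end RankOne

/-! ### Specker's triangle. -/

/-- Outcomes for three binary measurements: `Sum.inl i` is the positive outcome of measurement `i`,
and `Sum.inr (k, s, t)` is the joint outcome `s` of `k + 1` and `t` of `k + 2`. -/
abbrev SpeckerVertex : Type := Fin 3 ⊕ Fin 3 × Bool × Bool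

/-- The joint measurement of `k + 1` and `k + 2`. -/
def speckerJointEdge (k : Fin 3) : Finset SpeckerVertex :=
  {.inr (k, true, true), .inr (k, true, false), .inr (k, false, true), .inr (k, false, false)}

/-- The negative outcome of `k + 1` is refined by the joint measurement of `k + 1` and `k + 2`. -/
def speckerLeftEdge (k : Fin 3) : Finset SpeckerVertex :=
  {.inl (k + 1), .inr (k, false, true), .inr (k, false, false)}

/-- The negative outcome of `k + 2` is refined by the joint measurement of `k + 1` and `k + 2`. -/
def speckerRightEdge (k : Fin 3) : Finset SpeckerVertex :=
  {.inl (k + 2), .inr (k, true, false), .inr (k, false, false)}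

/-- Specker's triangle: three binary measurements, any two of which are jointly measurable. -/
def speckerScenario : ContextualityScenario SpeckerVertex where
  edges := {e | ∃ k, e = speckerJointEdge k ∨ e = speckerLeftEdge k ∨ e = speckerRightEdge k}
  cover v := by
    rcases v with i | ⟨k, s, t⟩
    -- In `Fin 3`, `(i + 2) + 1 = i`.
    · exact ⟨_, ⟨i + 2, Or.inr (Or.inl rfl)⟩, by revert i; decide⟩
    · exact ⟨_, ⟨k, Or.inl rfl⟩, by revert k s t; decide⟩

/-- Unbiased outcomes with pairwise correlation `-1/2`. -/
noncomputable def speckerModel : SpeckerVertex → ℝ :=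
  Sum.elim (fun _ => 1 / 2) fun a => if a.2.1 = a.2.2 then 1 / 8 else 3 / 8

theorem speckerModel_isProbabilisticModel :
    speckerScenario.IsProbabilisticModel speckerModel := by
  refine ⟨?_, ?_⟩
  · rintro (i | ⟨k, s, t⟩)
    · norm_num [speckerModel]
    · by_cases h : s = t <;> norm_num [speckerModel, h]
  · rintro _ ⟨k, rfl | rfl | rfl⟩
    · norm_num [speckerJointEdge, speckerModel]
    · rw [speckerLeftEdge, Finset.sum_insert (by simp), Finset.sum_insert (by simp),
        Finset.sum_singleton]
      norm_num [speckerModel]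
    · rw [speckerRightEdge, Finset.sum_insert (by simp), Finset.sum_insert (by simp),
        Finset.sum_singleton]
      norm_num [speckerModel]

/-! ### Vectors realizing the model up to normalization. -/

section Vectors

/-- The vector whose direction is the quantum state. -/
def speckerState : Fin 8 → ℤ := ![2, 2, 4, 0, 0, 0, 0, 0]

/-- Three vectors orthogonal to the state, with angles of 120 degrees between them. -/
def speckerAxis : Fin 3 → Fin 8 → ℤ :=
  ![![0, 0, 0, 4, -2, -2, 0, 0], ![0, 0, 0, -2, 4, -2, 0, 0], ![0, 0, 0, -2, -2, 4, 0, 0]]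

/-- A vector with the same inner product with the state as any two axes have with each other. -/
def speckerProduct : Fin 8 → ℤ := ![-1, -1, -2, 0, 0, 0, 3, 3]

/-- The sign of an outcome. -/
def outcomeSign (s : Bool) : ℤ := if s then 1 else -1

/-- A vector spanning the range of the projection of an outcome. -/
def speckerVector : SpeckerVertex → Fin 8 → ℤ
  | .inl i => speckerState + speckerAxis i
  | .inr (k, s, t) => speckerState + outcomeSign s • speckerAxis (k + 1) +
      outcomeSign t • speckerAxis (k + 2) + (outcomeSign s * outcomeSign t) • speckerProduct

/-- State, axes and product vector all have squared norm 24. State · product and axis · axis are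
-12; the other products are 0. So the vectors for signs `(s, t)` and `(s', t')` with the same `k`
have product `24 (1 + ss') (1 + tt') - 12 (s + s') (t + t')`, which is 0 if a sign differs. They
imitate four times the outcome projections applied to the state. All correlations being equal, one
product vector serves all three pairs. -/
theorem speckerVector_dotProduct_eq_zero {e : Finset SpeckerVertex}
    (he : e ∈ speckerScenario.edges) {a b : SpeckerVertex} (ha : a ∈ e) (hb : b ∈ e)
    (hab : a ≠ b) : speckerVector a ⬝ᵥ speckerVector b = 0 := by
  have h1 : ∀ k, ∀ a ∈ speckerJointEdge k, ∀ b ∈ speckerJointEdge k, a ≠ b →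
      speckerVector a ⬝ᵥ speckerVector b = 0 := by decide +kernel
  have h2 : ∀ k, ∀ a ∈ speckerLeftEdge k, ∀ b ∈ speckerLeftEdge k, a ≠ b →
      speckerVector a ⬝ᵥ speckerVector b = 0 := by decide +kernel
  have h3 : ∀ k, ∀ a ∈ speckerRightEdge k, ∀ b ∈ speckerRightEdge k, a ≠ b →
      speckerVector a ⬝ᵥ speckerVector b = 0 := by decide +kernel
  obtain ⟨k, rfl | rfl | rfl⟩ := he
  · exact h1 k a ha b hb hab
  · exact h2 k a ha b hb hab
  · exact h3 k a ha b hb hab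

theorem speckerVector_dotProduct_state (v : SpeckerVertex) :
    ((speckerVector v ⬝ᵥ speckerState : ℤ) : ℝ) ^ 2 / ((speckerVector v ⬝ᵥ speckerVector v : ℤ) : ℝ)
      / ((speckerState ⬝ᵥ speckerState : ℤ) : ℝ) = speckerModel v := by
  have h0 : speckerState ⬝ᵥ speckerState = 24 := by decide +kernel
  have h1 : ∀ i, speckerVector (.inl i) ⬝ᵥ speckerState = 24 ∧
      speckerVector (.inl i) ⬝ᵥ speckerVector (.inl i) = 48 := by decide +kernel
  have h2 : ∀ k s t, speckerVector (.inr (k, s, t)) ⬝ᵥ speckerState = (if s = t then 12 else 36) ∧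
      speckerVector (.inr (k, s, t)) ⬝ᵥ speckerVector (.inr (k, s, t)) =
        if s = t then 48 else 144 := by decide +kernel
  rcases v with i | ⟨k, s, t⟩
  · norm_num [h0, h1, speckerModel]
  · by_cases h : s = t
    · norm_num [h0, h2, speckerModel, h]
    · norm_num [h0, h2, speckerModel, h]

end Vectors

theorem speckerModel_isQuantumModel_pairScenario :
    ContextualityScenario.IsQuantumModel.{u} speckerScenario.pairScenario
      (speckerScenario.pairExtend speckerModel) := by
  have hψ : intVector.{u} speckerState ≠ 0 := fun h => by
    have h1 := norm_sq_intVector.{u} speckerState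
    rw [h, show speckerState ⬝ᵥ speckerState = 24 by decide +kernel] at h1
    norm_num at h1
  refine speckerModel_isProbabilisticModel.isQuantumModel_pairScenario
    (P := fun v => (ℂ ∙ intVector.{u} (speckerVector v)).starProjection)
    (isQuantumState_starProjection_singleton hψ) (fun v => isStarProjection_starProjection)
    (fun e he a ha b hb hab => starProjection_singleton_mul_eq_zero ?_) fun v => ?_
  · rw [inner_intVector, speckerVector_dotProduct_eq_zero he ha hb hab, Int.cast_zero]
  · convert hasTrace_starProjection_singleton_mul (intVector.{u} speckerState)
      isStarProjection_starProjection.isSelfAdjoint using 1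
    rw [Submodule.starProjection_singleton, inner_smul_right, inner_intVector, inner_intVector,
      norm_sq_intVector, norm_sq_intVector, ← speckerVector_dotProduct_state,
      dotProduct_comm speckerState (speckerVector v)]
    push_cast
    ring

/-! ### The obstruction to a quantum realization. -/

/-- For commuting projections: twice the projection onto the event that all three coincide is the
excess over `1` of the sum of the three pairwise coincidences. -/
theorem two_mul_add_one_sub_prod {R : Type*} [Ring R] {x y z : R} (hxz : Commute x z) :
    1 + 2 * (x * y * z + (1 - x) * (1 - y) * (1 - z)) =
      (x * y + (1 - x) * (1 - y)) + (y * z + (1 - y) * (1 - z)) +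
        (z * x + (1 - z) * (1 - x)) := by
  rw [← sub_eq_zero]
  noncomm_ring
  simp only [← hxz.eq]
  abel

theorem isStarProjection_coincidence {R : Type*} [Ring R] [StarRing R] {x y z : R}
    (hx : IsStarProjection x) (hy : IsStarProjection y) (hz : IsStarProjection z)
    (hxy : Commute x y) (hxz : Commute x z) (hyz : Commute y z) :
    IsStarProjection (x * y * z + (1 - x) * (1 - y) * (1 - z)) := by
  have hc {a b : R} (h : Commute a b) : Commute (1 - a) (1 - b) :=
    ((Commute.one_left _).sub_left ((Commute.one_right _).sub_right h))
  refine ((hx.mul hy hxy).mul hz (hxz.mul_left hyz)).add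
    ((hx.one_sub.mul hy.one_sub (hc hxy)).mul hz.one_sub ((hc hxz).mul_left (hc hyz))) ?_
  -- The two summands are orthogonal because `z * (1 - z) = 0`.
  have h : z * ((1 - x) * (1 - y) * (1 - z)) = 0 := by
    have h1 : Commute z ((1 - x) * (1 - y)) :=
      (((Commute.one_right _).sub_right hxz.symm).mul_right
        ((Commute.one_right _).sub_right hyz.symm))
    rw [← mul_assoc, h1.eq, mul_assoc, hz.mul_one_sub_self, mul_zero]
  rw [mul_assoc (x * y), h, mul_zero]

/-- Outcome projections of a joint measurement whose marginals are `x` and `y`. -/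
theorem joint_projection_products {R : Type*} [Ring R] {x y tt tf ft ff : R}
    (htt : tt * tt = tt) (hff : ff * ff = ff)
    (h12 : tt * tf = 0) (h13 : tt * ft = 0)
    (h21 : tf * tt = 0) (h23 : tf * ft = 0)
    (h31 : ft * tt = 0) (h32 : ft * tf = 0) (h34 : ft * ff = 0)
    (h42 : ff * tf = 0)
    (hsum : tt + tf + ft + ff = 1) (hx : x + ft + ff = 1) (hy : y + tf + ff = 1) :
    x * y = tt ∧ y * x = tt ∧ (1 - x) * (1 - y) = ff := by
  have ex : x = tt + tf := by
    rw [← hsum, add_assoc, add_assoc (tt + tf)] at hx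
    exact add_right_cancel hx
  have ey : y = tt + ft := by 
    rw [← hsum, add_assoc, show tt + tf + ft + ff = tt + ft + (tf + ff) by abel] at hy
    exact add_right_cancel hy
  have ex' : 1 - x = ft + ff := by rw [← hx]; abel
  have ey' : 1 - y = tf + ff := by rw [← hy]; abel
  rw [ex', ey', ex, ey]
  simp only [mul_add, add_mul, *, add_zero, zero_add, and_self]

theorem not_isQuantumModel_speckerModel :
    ¬ ContextualityScenario.IsQuantumModel.{u} speckerScenario speckerModel := by
  rintro ⟨-, 𝓗, _, _, _, ρ, P, ⟨hρ, hρ1⟩, hP, hsum, htr⟩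
  have hjoint : ∀ k, P (.inl (k + 1)) * P (.inl (k + 2)) = P (.inr (k, true, true)) ∧
      P (.inl (k + 2)) * P (.inl (k + 1)) = P (.inr (k, true, true)) ∧
      (1 - P (.inl (k + 1))) * (1 - P (.inl (k + 2))) = P (.inr (k, false, false)) := by
    intro k
    have hJ := hsum _ ⟨k, Or.inl rfl⟩
    have hL := hsum _ ⟨k, Or.inr (Or.inl rfl)⟩
    have hR := hsum _ ⟨k, Or.inr (Or.inr rfl)⟩
    have hmem : ∀ k s t, .inr (k, s, t) ∈ speckerJointEdge k := by decide
    have hort : ∀ s t s' t', (s, t) ≠ (s', t') → P (.inr (k, s, t)) * P (.inr (k, s', t')) = 0 :=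
      fun s t s' t' h => IsStarProjection.mul_eq_zero_of_sum_eq_one (fun v _ => hP v) hJ
        (hmem k s t) (hmem k s' t') (by simpa using h)
    simp [speckerJointEdge, ← add_assoc] at hJ
    simp [speckerLeftEdge, speckerRightEdge, ← add_assoc] at hL hR
    exact joint_projection_products (hP _).isIdempotentElem (hP _).isIdempotentElem
      (hort _ _ _ _ (by decide)) (hort _ _ _ _ (by decide)) (hort _ _ _ _ (by decide))
      (hort _ _ _ _ (by decide)) (hort _ _ _ _ (by decide)) (hort _ _ _ _ (by decide))
      (hort _ _ _ _ (by decide)) (hort _ _ _ _ (by decide)) hJ hL hR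
  obtain ⟨a1, a2, a3⟩ : P (.inl 1) * P (.inl 2) = P (.inr (0, true, true)) ∧
    P (.inl 2) * P (.inl 1) = P (.inr (0, true, true)) ∧
    (1 - P (.inl 1)) * (1 - P (.inl 2)) = P (.inr (0, false, false)) := hjoint 0
  obtain ⟨b1, b2, b3⟩ : P (.inl 2) * P (.inl 0) = P (.inr (1, true, true)) ∧
    P (.inl 0) * P (.inl 2) = P (.inr (1, true, true)) ∧
    (1 - P (.inl 2)) * (1 - P (.inl 0)) = P (.inr (1, false, false)) := hjoint 1
  obtain ⟨c1, c2, c3⟩ : P (.inl 0) * P (.inl 1) = P (.inr (2, true, true)) ∧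
    P (.inl 1) * P (.inl 0) = P (.inr (2, true, true)) ∧
    (1 - P (.inl 0)) * (1 - P (.inl 1)) = P (.inr (2, false, false)) := hjoint 2
  have h01 : Commute (P (.inl 0)) (P (.inl 1)) := c1.trans c2.symm
  have h02 : Commute (P (.inl 0)) (P (.inl 2)) := b2.trans b1.symm
  have h12 : Commute (P (.inl 1)) (P (.inl 2)) := a1.trans a2.symm
  have hG := isStarProjection_coincidence (hP (.inl 0)) (hP (.inl 1)) (hP (.inl 2)) h01 h02 h12
  have key := two_mul_add_one_sub_prod (y := P (.inl 1)) h02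
  set G := P (.inl 0) * P (.inl 1) * P (.inl 2) +
    (1 - P (.inl 0)) * (1 - P (.inl 1)) * (1 - P (.inl 2))
  clear_value G
  rw [a1, a3, b1, b3, c1, c3] at key
  -- Each coincidence has probability 1/8 + 1/8, so `ρ * G` would have trace (3/4 - 1)/2 = -1/8.
  have hGtr := (((((htr (.inr (2, true, true))).add (htr (.inr (2, false, false)))).add
    ((htr (.inr (0, true, true))).add (htr (.inr (0, false, false))))).add
    ((htr (.inr (1, true, true))).add (htr (.inr (1, false, false))))).sub hρ1).smul (1 / 2)
  have hGeq : ρ * G = (1 / 2 : ℂ) • (ρ * P (.inr (2, true, true)) + ρ * P (.inr (2, false, false)) +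
      (ρ * P (.inr (0, true, true)) + ρ * P (.inr (0, false, false))) +
      (ρ * P (.inr (1, true, true)) + ρ * P (.inr (1, false, false))) - ρ) := by
    simp only [← mul_add, ← key]
    rw [mul_add, mul_one, add_sub_cancel_left, two_mul, mul_add, ← two_smul ℂ, smul_smul]
    norm_num
  rw [← hGeq] at hGtr
  have := hGtr.re_nonneg_of_isPositive_mul_isStarProjection hρ hG
  norm_num [speckerModel] at this

/-! ### Conclusion. -/

theorem exists_isQuantumModel_not_isQuantumModel :
    ∃ (V : Type) (_ : Finite V) (H H' : ContextualityScenario V) (p : V → ℝ),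
      H.nonOrthogonalityGraph = H'.nonOrthogonalityGraph ∧
      H.IsProbabilisticModel p ∧ H'.IsProbabilisticModel p ∧
      ContextualityScenario.IsQuantumModel.{u, 0} H p ∧
      ¬ ContextualityScenario.IsQuantumModel.{u, 0} H' p :=
  ⟨SpeckerVertex ⊕ speckerScenario.OrthoPair, inferInstance, speckerScenario.pairScenario,
    speckerScenario.fullScenario, speckerScenario.pairExtend speckerModel,
    speckerScenario.nonOrthogonalityGraph_pairScenario,
    speckerModel_isProbabilisticModel.pairScenario, speckerModel_isProbabilisticModel.fullScenario,
    speckerModel_isQuantumModel_pairScenario,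
    fun h => not_isQuantumModel_speckerModel h.of_fullScenario⟩

theorem mainTheorem3 :
    (∃ (V : Type) (_ : Finite V) (H H' : ContextualityScenario V) (p : V → ℝ),
      H.nonOrthogonalityGraph = H'.nonOrthogonalityGraph ∧
      H.IsProbabilisticModel p ∧ H'.IsProbabilisticModel p ∧
      ContextualityScenario.IsQuantumModel.{u, 0} H p ∧
      ¬ ContextualityScenario.IsQuantumModel.{u, 0} H' p) ∧
    ∀ (α : Type w) (X : WeightedGraphInvariant α) (S : Set α),
      ¬ ∀ (V : Type) (_ : Finite V) (H : ContextualityScenario V) (p : V → ℝ),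
        H.IsProbabilisticModel p →
          (ContextualityScenario.IsQuantumModel.{u, 0} H p ↔
            X.val H.nonOrthogonalityGraph p ∈ S) := by
  refine ⟨exists_isQuantumModel_not_isQuantumModel, fun α X S h => ?_⟩
  obtain ⟨V, hV, H, H', p, hgraph, hp, hp', hq, hq'⟩ :=
    exists_isQuantumModel_not_isQuantumModel.{u}
  -- Both scenarios give the same weighted graph, so `X` cannot separate them.
  exact hq' ((h V hV H' p hp').2 (hgraph ▸ (h V hV H p hp).1 hq))
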